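/- Let $I=[0,1]$ and let $I^{\omega_1}$ carry the product topology. A topological space $X$ is productively Lindelöf if $X$ is Lindelöf and $X\times Y$ is Lindelöf for every Lindelöf space $Y$. A Michael space is a Lindelöf space whose product with the space $\mathbb R\setminus\mathbb Q$ of irrational numbers is not Lindelöf. (No separation axioms are part of these definitions.) A family $\mathcal G$ of subsets of $I^{\omega_1}$ is an Alster covering of a subspace $X\subseteq I^{\omega_1}$ if $G\cap X$ is a $G_\delta$ subset of $X$ for each $G\in\mathcal G$ and for every compact $K\subseteq X$ there is $G\in\mathcal G$ with $K\subseteq G$. **Corollary 3.4.** Suppose that there exists a Michael space. Let $X\subseteq I^{\omega_1}$ be a productively Lindelöf subspace, and let $\mathcal G$ be an Alster covering of $X$ of cardinality $|\mathcal G|=\omega_1$ that consists of Lindelöf $G_\delta$ subsets of $I^{\omega_1}$. Then there is a countably infinite subfamily $\mathcal G'\subseteq\mathcal G$ such that $X\subseteq\bigcup\mathcal G'$. -/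

import Mathlib

open scoped Cardinal Ordinal unitInterval

universe u

/-- A topological space `X` is productively Lindelöf if it is Lindelöf and `X × Y` is Lindelöf
for every Lindelöf space `Y` (no separation axiom is imposed on `Y`). -/
def ProductivelyLindelof (X : Type*) [TopologicalSpace X] : Prop :=
  LindelofSpace X ∧
    ∀ (Y : Type u) [TopologicalSpace Y], LindelofSpace Y → LindelofSpace (X × Y)

/-- A topological space `Y` is a Michael space if it is Lindelöf and its product with the space
of irrational numbers (with the topology inherited from `ℝ`) is not Lindelöf. -/
def IsMichaelSpace (Y : Type*) [TopologicalSpace Y] : Prop :=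
  LindelofSpace Y ∧ ¬ LindelofSpace (Y × {x : ℝ // Irrational x})

/-- A family `𝒢` of subsets of a topological space `X` is an Alster covering of `X` if all its
members are `G_δ` in `X` and every compact subset of `X` lies in a member of `𝒢`. -/
def IsAlsterCovering (X : Type*) [TopologicalSpace X] (𝒢 : Set (Set X)) : Prop :=
  (∀ G ∈ 𝒢, IsGδ G) ∧ ∀ K : Set X, IsCompact K → ∃ G ∈ 𝒢, K ⊆ G

/-- The Tychonoff cube `I^{ω₁}`, where `I = [0,1]`, with the product topology; the coordinates are
indexed by the ordinals below `ω₁`. -/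
abbrev TychonoffCube : Type := (ω₁ : Ordinal.{0}).ToType → I

/-!
The compact space `[0,1]^ω₁` is the limit of its metrizable projections to the initial segments of
`ω₁`, and a Lindelöf subspace is determined by its images there
(`mem_of_forall_exists_restrict_mem`).

**Closed members.** Suppose first that the `α`-th member of the cover is the set of points whose
`α`-th coordinate lies in a fixed closed set `N`, in a power of a compact metrizable space. If no
countable subfamily covers `X`, there are points `a δ ∈ X` avoiding the members below `δ`. The
space `Y` consists of the isolated points `a δ` and of `remainder N X`, the set of points that are
seen to lie outside `X` by some initial segment of coordinates avoiding `N`. The diagonal shows that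
`X × Y` is not Lindelöf, because a countable set of points of `X` is covered by countably many
members. So it suffices that `Y` is Lindelöf, which amounts to the following: an open set containing
the remainder contains all points avoiding the members below some `δ`. Let `K` be the complement of
such an open set. The part of `K` avoiding the members below `δ` projects to a `G_δ` set contained in
the projection of `X`.

A Michael space enters here: the projection of `X` is productively Lindelöf with this space, so it
has no closed subset mapping onto the Baire space. Hence, by a Hurewicz-type dichotomy
(`exists_open_inter_closure_subset`), the closure of the `G_δ` set is, on some nonempty open part,
contained in the projection of `X`. Pressing down makes that open part independent of `δ`, which
produces a compact subset of `X`, and its inclusion in a single member of the cover is contradictory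
(`exists_disjoint_avoidBelow`).

**Members that are `G_δ`.** If `G α = ⋂ n, O α n`, the compact factor `[0,1]^ω₁` is added, and `X` is
replaced by pairs `(x, t)` where the size of `t α` controls how early `x` leaves `O α 0, O α 1, …`
(`avoidanceGraph`). This space is again productively Lindelöf, and the closed sets `t α = 0` take
over the role of the sets `G α`.
-/

open Set Filter Topology Metric

/-! ### Lindelöf spaces and proper maps -/

theorem IsProperMap.isLindelof_preimage {A B : Type*} [TopologicalSpace A] [TopologicalSpace B]
    {f : A → B} (hf : IsProperMap f) {T : Set B} (hT : IsLindelof T) :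
    IsLindelof (f ⁻¹' T) := by
  intro ℱ _ _ hℱ
  have hle : map f ℱ ≤ 𝓟 T := by
    rw [le_principal_iff, mem_map]
    exact le_principal_iff.1 hℱ
  obtain ⟨y, hyT, hy⟩ := hT hle
  obtain ⟨x, rfl, hx⟩ := hf.clusterPt_of_mapClusterPt hy
  exact ⟨x, hyT, hx⟩

theorem CompactSpace.lindelofSpace_prod (K Y : Type*) [TopologicalSpace K] [TopologicalSpace Y]
    [CompactSpace K] [LindelofSpace Y] : LindelofSpace (K × Y) := by
  rw [← isLindelof_univ_iff]
  exact isProperMap_snd_of_compactSpace.isLindelof_preimage (isLindelof_univ (X := Y))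

/-! ### A Hurewicz-type dichotomy -/

theorem exists_continuous_surjective_irrational :
    ∃ g : (ℕ → ℕ) → {x : ℝ // Irrational x}, Continuous g ∧ Function.Surjective g := by
  have h : MeasureTheory.AnalyticSet {x : ℝ | Irrational x} :=
    IsGδ.setOfPred_irrational.measurableSet.analyticSet
  rw [MeasureTheory.AnalyticSet] at h
  rcases h with h | ⟨g, hg, hr⟩
  · exact absurd h (Set.Nonempty.ne_empty ⟨√2, irrational_sqrt_two⟩)
  · have hmem : ∀ x, Irrational (g x) := fun x => by
      have : g x ∈ {x : ℝ | Irrational x} := hr ▸ mem_range_self x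
      exact this
    refine ⟨fun x => ⟨g x, hmem x⟩, hg.subtype_mk _, fun ⟨y, hy⟩ => ?_⟩
    have : y ∈ range g := hr ▸ hy
    obtain ⟨x, rfl⟩ := this
    exact ⟨x, rfl⟩

/-- A point `q` accumulated by `D ∩ O` is the limit of a sequence of disjoint closed balls in `O` with
centres in `D`: choose the centres so that their distances to `q` more than halve at each step, and
the radii at most a quarter of these distances. -/
theorem exists_disjoint_closedBalls {E : Type*} [MetricSpace E] {D O : Set E} {q : E}
    (hD : ∀ ε > 0, ∃ c ∈ D ∩ O, c ≠ q ∧ dist c q < ε) (hO : IsOpen O) {r : ℝ} (hr : 0 < r) :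
    ∃ c : ℕ → E × ℝ, (∀ n, (c n).1 ∈ D ∧ 0 < (c n).2) ∧
      (∀ n, closedBall (c n).1 (c n).2 ⊆ O) ∧
      (∀ n, closedBall (c n).1 (c n).2 ⊆ closedBall q (r / 2)) ∧
      (∀ n : ℕ, closedBall (c n).1 (c n).2 ⊆ closedBall q (1 / (n + 1))) ∧
      Pairwise fun m n => Disjoint (closedBall (c m).1 (c m).2) (closedBall (c n).1 (c n).2) := by
  have : Nonempty E := ⟨q⟩
  choose! F hFmem hFne hFlt using hD
  have hρ : ∀ x ∈ O, x ≠ q → ∃ ρ > 0, ρ ≤ dist x q / 4 ∧ closedBall x ρ ⊆ O := by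
    intro x hx hxq
    obtain ⟨ε, hε, hsub⟩ := nhds_basis_closedBall.mem_iff.1 (hO.mem_nhds hx)
    have : 0 < dist x q := dist_pos.2 hxq
    exact ⟨min ε (dist x q / 4), by positivity, min_le_right _ _,
      (closedBall_subset_closedBall (min_le_left _ _)).trans hsub⟩
  choose! ρ hρpos hρle hρO using hρ
  let ε : ℕ → ℝ := fun n => Nat.rec (min (r / 4) (1 / 2))
    (fun n e => min (dist (F e) q / 2) (min (r / 4) (1 / (2 * ((n : ℝ) + 2))))) n
  have hε0 : ε 0 = min (r / 4) (1 / 2) := rfl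
  have hεs : ∀ n, ε (n + 1) =
      min (dist (F (ε n)) q / 2) (min (r / 4) (1 / (2 * ((n : ℝ) + 2)))) := fun _ => rfl
  have hεpos : ∀ n, 0 < ε n := by
    intro n
    induction n with
    | zero => rw [hε0]; positivity
    | succ n ih =>
      have := dist_pos.2 (hFne _ ih)
      rw [hεs]; positivity
  have hεr : ∀ n, ε n ≤ r / 4 := by
    rintro (_ | n)
    · exact min_le_left _ _
    · rw [hεs]; exact (min_le_right _ _).trans (min_le_left _ _)
  have hεn : ∀ n : ℕ, ε n ≤ 1 / (2 * ((n : ℝ) + 1)) := by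
    rintro (_ | n)
    · rw [hε0]; simp
    · rw [hεs]
      refine ((min_le_right _ _).trans (min_le_right _ _)).trans (le_of_eq ?_)
      push_cast; ring
  set c : ℕ → E := fun n => F (ε n) with hc
  have hcq : ∀ n, 0 < dist (c n) q := fun n => dist_pos.2 (hFne _ (hεpos n))
  have hcε : ∀ n, dist (c n) q < ε n := fun n => hFlt _ (hεpos n)
  have hcO : ∀ n, c n ∈ O := fun n => (hFmem _ (hεpos n)).2
  have hρc : ∀ n, ρ (c n) ≤ dist (c n) q / 4 := fun n => hρle _ (hcO n) (hFne _ (hεpos n))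
  have hmono : ∀ m n, m < n → dist (c n) q < dist (c m) q / 2 := by
    intro m n hmn
    induction n, hmn using Nat.le_induction with
    | base => exact (hcε (m + 1)).trans_le ((hεs m).trans_le (min_le_left _ _))
    | succ n _ ih =>
      have h1 : dist (c (n + 1)) q < dist (c n) q / 2 :=
        (hcε (n + 1)).trans_le ((hεs n).trans_le (min_le_left _ _))
      linarith [hcq n]
  have hup : ∀ n, ∀ z ∈ closedBall (c n) (ρ (c n)), dist z q ≤ 5 / 4 * dist (c n) q := by
    intro n z hz
    have := mem_closedBall.1 hz
    linarith [dist_triangle z (c n) q, hρc n]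
  have hlow : ∀ n, ∀ z ∈ closedBall (c n) (ρ (c n)), 3 / 4 * dist (c n) q ≤ dist z q := by
    intro n z hz
    have := mem_closedBall'.1 hz
    linarith [dist_triangle (c n) z q, hρc n]
  have hdisj : ∀ m n, m < n →
      Disjoint (closedBall (c m) (ρ (c m))) (closedBall (c n) (ρ (c n))) := by
    intro m n hmn
    rw [Set.disjoint_left]
    intro z hzm hzn
    linarith [hlow m z hzm, hup n z hzn, hmono m n hmn, hcq m]
  refine ⟨fun n => (c n, ρ (c n)), fun n => ⟨(hFmem _ (hεpos n)).1,
    hρpos _ (hcO n) (hFne _ (hεpos n))⟩, fun n => hρO _ (hcO n) (hFne _ (hεpos n)), ?_, ?_, ?_⟩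
  · intro n z hz
    have := hup n z hz
    rw [mem_closedBall]
    linarith [hcε n, hεr n]
  · intro n z hz
    have := hup n z hz
    have h2 := hεn n
    have h3 : 1 / (2 * ((n : ℝ) + 1)) = 1 / ((n : ℝ) + 1) / 2 := by field_simp
    have h4 : 0 < 1 / ((n : ℝ) + 1) := by positivity
    rw [mem_closedBall]
    linarith [hcε n]
  · intro m n hmn
    rcases lt_or_gt_of_ne hmn with h | h
    · exact hdisj m n h
    · exact (hdisj n m h).symm

/-- A Lusin scheme of balls with centres in `D`, indexed by finite sequences with the last entry at
the head of the list. The children of a ball are disjoint and converge to its centre. -/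
theorem exists_ball_scheme {E : Type*} [MetricSpace E] {D : Set E} {O : ℕ → Set E}
    (hO : ∀ k, IsOpen (O k))
    (hD : ∀ k, ∀ q ∈ D, ∀ ε > 0, ∃ c ∈ D ∩ O k, c ≠ q ∧ dist c q < ε) (hne : D.Nonempty) :
    ∃ (q : List ℕ → E) (r : List ℕ → ℝ), (∀ s, q s ∈ D) ∧ (∀ s, 0 < r s) ∧
      (∀ s n, closedBall (q (n :: s)) (r (n :: s)) ⊆ O s.length) ∧
      (∀ s n, closedBall (q (n :: s)) (r (n :: s)) ⊆ closedBall (q s) (r s / 2)) ∧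
      (∀ s (n : ℕ), closedBall (q (n :: s)) (r (n :: s)) ⊆ closedBall (q s) (1 / (n + 1))) ∧
      ∀ s, Pairwise fun m n => Disjoint (closedBall (q (m :: s)) (r (m :: s)))
        (closedBall (q (n :: s)) (r (n :: s))) := by
  obtain ⟨q₀, hq₀⟩ := hne
  have step : ∀ (k : ℕ) (p : E × ℝ), p.1 ∈ D ∧ 0 < p.2 → ∃ c : ℕ → E × ℝ,
      (∀ n, (c n).1 ∈ D ∧ 0 < (c n).2) ∧
      (∀ n, closedBall (c n).1 (c n).2 ⊆ O k) ∧
      (∀ n, closedBall (c n).1 (c n).2 ⊆ closedBall p.1 (p.2 / 2)) ∧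
      (∀ n : ℕ, closedBall (c n).1 (c n).2 ⊆ closedBall p.1 (1 / (n + 1))) ∧
      Pairwise fun m n => Disjoint (closedBall (c m).1 (c m).2) (closedBall (c n).1 (c n).2) :=
    fun k p hp => exists_disjoint_closedBalls (hD k p.1 hp.1) (hO k) hp.2
  choose! c hc using step
  let S : List ℕ → E × ℝ := fun s => List.rec (q₀, 1) (fun n s p => c s.length p n) s
  have hSs : ∀ n s, S (n :: s) = c s.length (S s) n := fun _ _ => rfl
  have hS : ∀ s, (S s).1 ∈ D ∧ 0 < (S s).2 := by
    intro s
    induction s with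
    | nil => exact ⟨hq₀, one_pos⟩
    | cons n s ih => exact (hc s.length (S s) ih).1 n
  exact ⟨fun s => (S s).1, fun s => (S s).2, fun s => (hS s).1, fun s => (hS s).2,
    fun s n => (hc s.length (S s) (hS s)).2.1 n, fun s n => (hc s.length (S s) (hS s)).2.2.1 n,
    fun s n => (hc s.length (S s) (hS s)).2.2.2.1 n,
    fun s => (hc s.length (S s) (hS s)).2.2.2.2⟩

/-- If `closure A \ T` meets every open set that meets the `G_δ` set `A ⊆ T`, then some closed subset
of `T` maps continuously onto `ℕ → ℕ`, so the factor `T` of a Lindelöf product can be replaced by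
the space of irrational numbers. The closed set consists of the branches of a ball scheme with
centres in `closure A \ T`: the only other limits of branches are the centres, which are not in
`T`. -/
theorem lindelofSpace_prod_irrational_of_codense {E : Type*} [MetricSpace E] [CompactSpace E]
    {A T : Set E} (hA : IsGδ A) (hAT : A ⊆ T) (hne : A.Nonempty)
    (hdense : ∀ V, IsOpen V → (V ∩ A).Nonempty → (V ∩ (closure A \ T)).Nonempty)
    (M : Type*) [TopologicalSpace M] (hTM : LindelofSpace (T × M)) :
    LindelofSpace (M × {x : ℝ // Irrational x}) := by
  obtain ⟨O, hO, hAO⟩ := hA.eq_iInter_nat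
  obtain ⟨q, r, hqD, hr, hBO, hhalf, hsmall, hdisj⟩ :=
      exists_ball_scheme (D := closure A \ T) hO (by
    intro k x hx ε hε
    obtain ⟨a, ha, hax⟩ := Metric.mem_closure_iff.1 hx.1 ε hε
    have hne : a ≠ x := fun h => hx.2 (hAT (h ▸ ha))
    have haO : a ∈ O k := by rw [hAO] at ha; exact mem_iInter.1 ha k
    obtain ⟨c, ⟨⟨hcε, hcO⟩, hcx⟩, hcD⟩ := hdense (ball x ε ∩ O k ∩ {x}ᶜ)
      ((isOpen_ball.inter (hO k)).inter isOpen_compl_singleton)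
      ⟨a, ⟨⟨by rwa [mem_ball'], haO⟩, hne⟩, ha⟩
    exact ⟨c, ⟨hcD, hcO⟩, hcx, hcε⟩) (by
    obtain ⟨x, -, hx⟩ := hdense univ isOpen_univ (by simpa using hne)
    exact ⟨x, hx⟩)
  have hchild : ∀ s n, closedBall (q (n :: s)) (r (n :: s)) ⊆ ball (q s) (r s) := fun s n =>
    (hhalf s n).trans (closedBall_subset_ball (by linarith [hr s]))
  have huniq : ∀ (s t : List ℕ) (y : E), s.length = t.length → y ∈ ball (q s) (r s) →
      y ∈ ball (q t) (r t) → s = t := by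
    intro s
    induction s with
    | nil => intro t y h _ _; exact (List.length_eq_zero_iff.1 h.symm).symm
    | cons m s ih =>
      rintro (_ | ⟨n, t⟩) y h hs ht
      · simp at h
      · have hst : s = t := ih t y (by simpa using h) (hchild s m (ball_subset_closedBall hs))
          (hchild t n (ball_subset_closedBall ht))
        subst hst
        by_contra hne
        exact Set.disjoint_left.1 (hdisj s fun hmn => hne (by rw [hmn]))
          (ball_subset_closedBall hs) (ball_subset_closedBall ht)
  have huniq' : ∀ (f g : ℕ → ℕ) (n : ℕ) (y : E), y ∈ ball (q (PiNat.res f n)) (r (PiNat.res f n)) →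
      y ∈ ball (q (PiNat.res g n)) (r (PiNat.res g n)) → PiNat.res f n = PiNat.res g n :=
    fun f g n y => huniq _ _ y (by simp)
  -- `Φ` is the set of points of `T` that lie on a branch of the scheme.
  let Φ : Set T := {x | ∃ f : ℕ → ℕ, ∀ n, (x : E) ∈ ball (q (PiNat.res f n)) (r (PiNat.res f n))}
  let Ψ : List ℕ → Set T := fun s => Φ ∩ (↑) ⁻¹' ball (q s) (r s)
  have hΨs : ∀ s, Ψ s ⊆ ⋃ n, Ψ (n :: s) := by
    rintro s x ⟨⟨f, hf⟩, hx⟩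
    have hs : PiNat.res f s.length = s := huniq _ _ (x : E) (by simp) (hf _) hx
    have h := hf (s.length + 1)
    rw [PiNat.res_succ, hs] at h
    exact mem_iUnion.2 ⟨_, ⟨f, hf⟩, h⟩
  have hΨn : ∀ s (n : ℕ), Ψ (n :: s) ⊆ (↑) ⁻¹' closedBall (q s) (1 / ((n : ℝ) + 1)) :=
    fun s n x hx => hsmall s n (ball_subset_closedBall hx.2)
  have hΨball : ∀ s n, closure (Ψ (n :: s)) ⊆ (↑) ⁻¹' ball (q s) (r s) := by
    intro s n
    have hsub : Ψ (n :: s) ⊆ (↑) ⁻¹' closedBall (q (n :: s)) (r (n :: s)) :=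
      fun x hx => ball_subset_closedBall hx.2
    exact (closure_minimal hsub (isClosed_closedBall.preimage continuous_subtype_val)).trans
      (preimage_mono (hchild s n))
  -- As the children of `s` converge to `q s ∉ T`, a point of `T` is near finitely many of them only.
  have hstep : ∀ s (x : T), x ∈ closure (Ψ s) → ∃ n, x ∈ closure (Ψ (n :: s)) := by
    intro s x hx
    have hd : 0 < dist (x : E) (q s) := dist_pos.2 fun h => (hqD s).2 (h ▸ x.2)
    obtain ⟨N, hN⟩ := exists_nat_one_div_lt hd
    have hsub : Ψ s ⊆ (⋃ n ∈ Finset.range N, closure (Ψ (n :: s))) ∪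
        (↑) ⁻¹' closedBall (q s) (1 / ((N : ℝ) + 1)) := by
      intro y hy
      obtain ⟨n, hn⟩ := mem_iUnion.1 (hΨs s hy)
      rcases lt_or_ge n N with h | h
      · exact Or.inl (mem_biUnion (Finset.mem_coe.2 (Finset.mem_range.2 h)) (subset_closure hn))
      · refine Or.inr (closedBall_subset_closedBall ?_ (hΨn s n hn))
        have : (N : ℝ) ≤ n := by exact_mod_cast h
        gcongr
    have hcl := closure_minimal hsub
      ((isClosed_biUnion_finset fun n _ => isClosed_closure).union
        (isClosed_closedBall.preimage continuous_subtype_val)) hx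
    rcases hcl with h | h
    · simp only [mem_iUnion] at h
      obtain ⟨n, -, h⟩ := h
      exact ⟨n, h⟩
    · exact absurd (mem_closedBall.1 h) (not_le.2 hN)
  have hΦclosed : IsClosed Φ := by
    refine isClosed_of_closure_subset fun x hx => ?_
    have h0 : x ∈ closure (Ψ []) := by
      have hsub : Φ ⊆ Ψ [] := fun y hy => ⟨hy, hy.choose_spec 0⟩
      exact closure_mono hsub hx
    choose! nx hnx using hstep
    let st : ℕ → List ℕ := fun n => Nat.rec [] (fun _ s => nx s x :: s) n
    have hst : ∀ n, x ∈ closure (Ψ (st n)) := by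
      intro n
      induction n with
      | zero => exact h0
      | succ n ih => exact hnx _ x ih
    have hres : ∀ n, PiNat.res (fun n => nx (st n) x) n = st n := by
      intro n
      induction n with
      | zero => rfl
      | succ n ih => rw [PiNat.res_succ, ih]
    exact ⟨fun n => nx (st n) x, fun n => by rw [hres]; exact hΨball _ _ (hst (n + 1))⟩
  have hψ : ∀ x : T, ∃ f : ℕ → ℕ, x ∈ Φ →
      ∀ n, (x : E) ∈ ball (q (PiNat.res f n)) (r (PiNat.res f n)) := by
    intro x
    by_cases h : x ∈ Φ
    · exact ⟨h.choose, fun _ => h.choose_spec⟩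
    · exact ⟨0, fun h' => absurd h' h⟩
  choose ψ hψ using hψ
  have hψcont : ContinuousOn ψ Φ := by
    refine continuousOn_pi.2 fun n x hx => ?_
    refine tendsto_nhds_of_eventually_eq ?_
    have hmem : (↑) ⁻¹' ball (q (PiNat.res (ψ x) (n + 1))) (r (PiNat.res (ψ x) (n + 1))) ∈ 𝓝 x :=
      (isOpen_ball.preimage continuous_subtype_val).mem_nhds (hψ x hx (n + 1))
    filter_upwards [mem_nhdsWithin_of_mem_nhds hmem, self_mem_nhdsWithin] with y hy hyΦ
    have := huniq' _ _ _ (y : E) hy (hψ y hyΦ (n + 1))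
    exact (PiNat.res_eq_res.1 this (Nat.lt_succ_self n)).symm
  have hψsurj : ∀ f, ∃ x ∈ Φ, ψ x = f := by
    intro f
    obtain ⟨x, hx⟩ := IsCompact.nonempty_iInter_of_sequence_nonempty_isCompact_isClosed
      (fun n => closedBall (q (PiNat.res f n)) (r (PiNat.res f n)))
      (fun n => (hchild _ _).trans ball_subset_closedBall)
      (fun n => nonempty_closedBall.2 (hr _).le) (isCompact_closedBall _ _)
      (fun n => isClosed_closedBall)
    rw [mem_iInter] at hx
    have hxA : x ∈ A := by
      rw [hAO, mem_iInter]
      intro n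
      have := hBO _ _ (hx (n + 1))
      rwa [PiNat.res_length] at this
    have hxf : ∀ n, x ∈ ball (q (PiNat.res f n)) (r (PiNat.res f n)) :=
      fun n => hchild _ _ (hx (n + 1))
    have hxΦ : (⟨x, hAT hxA⟩ : T) ∈ Φ := ⟨f, hxf⟩
    exact ⟨_, hxΦ, PiNat.res_injective (funext fun n => huniq' _ _ n x (hψ _ hxΦ n) (hxf n))⟩
  obtain ⟨g, hg, hgs⟩ := exists_continuous_surjective_irrational
  have hcl : IsLindelof {p : T × M | p.1 ∈ Φ} := (hΦclosed.preimage continuous_fst).isLindelof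
  have himg := hcl.image_of_continuousOn (f := fun p => (p.2, g (ψ p.1)))
    (continuous_snd.continuousOn.prodMk (hg.comp_continuousOn
      (hψcont.comp continuous_fst.continuousOn fun _ hp => hp)))
  rw [← isLindelof_univ_iff]
  convert himg
  refine (eq_univ_of_forall ?_).symm
  rintro ⟨m, y⟩
  obtain ⟨f, rfl⟩ := hgs y
  obtain ⟨x, hx, rfl⟩ := hψsurj f
  exact ⟨(x, m), hx, rfl⟩

/-- If the product of `T` with some Michael space is Lindelöf, then every nonempty `G_δ` set `A ⊆ T` has
its closure locally contained in `T` at some point. -/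
theorem exists_open_inter_closure_subset {E : Type*} [TopologicalSpace E] [CompactSpace E]
    [TopologicalSpace.MetrizableSpace E]
    {A T : Set E} (hA : IsGδ A) (hAT : A ⊆ T) (hne : A.Nonempty)
    {M : Type*} [TopologicalSpace M] (hM : ¬ LindelofSpace (M × {x : ℝ // Irrational x}))
    (hTM : LindelofSpace (T × M)) :
    ∃ V, IsOpen V ∧ (V ∩ A).Nonempty ∧ V ∩ closure A ⊆ T := by
  let := TopologicalSpace.metrizableSpaceMetric E
  by_contra! h
  refine hM (lindelofSpace_prod_irrational_of_codense hA hAT hne (fun V hV hVA => ?_) M hTM)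
  obtain ⟨x, ⟨hxV, hxA⟩, hxT⟩ := not_subset.1 (h V hV hVA)
  exact ⟨x, hxV, hxA, hxT⟩

/-! ### Linear orders of type `ω₁` -/

section Order

variable {J : Type*} [LinearOrder J]

/-- Initial segments being countable and `J` uncountable, countable sets are bounded: `J` has
cofinality greater than `ω`. -/
theorem exists_strict_upper_bound_of_countable [Uncountable J] (hJ : ∀ δ : J, (Iio δ).Countable)
    {s : Set J} (hs : s.Countable) : ∃ δ, ∀ i ∈ s, i < δ := by
  by_contra! h
  have hIic : ∀ i : J, (Iic i).Countable := fun i => by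
    rw [← Iio_insert]; exact (hJ i).insert i
  refine not_countable_univ (α := J) ((hs.biUnion fun i _ => hIic i).mono fun δ _ => ?_)
  obtain ⟨i, hi, hδ⟩ := h δ
  exact mem_biUnion hi hδ

/-- The case of the pressing down lemma used below: no function `γ` can send, for every `δ`, some
finite set with first coordinates below `δ` to a bound that is at least `δ`. -/
theorem exists_closed_under_finset_map [WellFoundedLT J] [Uncountable J]
    (hJ : ∀ δ : J, (Iio δ).Countable) {β : Type*} [Countable β] (γ : Finset (J × β) → J) :
    ∃ δ, ∀ b : Finset (J × β), (∀ x ∈ b, x.1 < δ) → γ b < δ := by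
  have hcount : ∀ δ, {b : Finset (J × β) | ∀ x ∈ b, x.1 < δ}.Countable := by
    intro δ
    have h := countable_ofPred_finite_subset ((hJ δ).prod (countable_univ (α := β)))
    refine (h.preimage (f := fun b : Finset (J × β) => (b : Set (J × β)))
      Finset.coe_injective).mono fun b hb => ?_
    exact And.intro b.finite_toSet fun x hx => ⟨hb x hx, mem_univ _⟩
  have hnext : ∀ δ, ∃ δ', δ < δ' ∧
      ∀ b : Finset (J × β), (∀ x ∈ b, x.1 < δ) → γ b < δ' := by
    intro δ
    obtain ⟨δ', h⟩ := exists_strict_upper_bound_of_countable hJ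
      (((hcount δ).image γ).insert δ)
    exact ⟨δ', h δ (mem_insert _ _),
      fun b hb => h _ (mem_insert_of_mem _ (mem_image_of_mem _ hb))⟩
  choose h hlt hγ using hnext
  obtain ⟨δ₀⟩ : Nonempty J := inferInstance
  let d : ℕ → J := fun n => h^[n] δ₀
  have hds : ∀ n, d (n + 1) = h (d n) := fun n => Function.iterate_succ_apply' h n δ₀
  have hmono : Monotone d := monotone_nat_of_le_succ fun n => by rw [hds]; exact (hlt _).le
  obtain ⟨δ, hδ, hmin⟩ := WellFounded.has_min (wellFounded_lt (α := J)) {δ | ∀ n, d n < δ} (by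
    obtain ⟨δ, h⟩ := exists_strict_upper_bound_of_countable hJ (countable_range d)
    exact ⟨δ, fun n => h _ (mem_range_self n)⟩)
  have hcof : ∀ i < δ, ∃ n, i < d n := by
    intro i hi
    by_contra! hcon
    refine hmin i (fun n => ?_) hi
    exact ((hlt _).trans_eq (hds n).symm).trans_le (hcon (n + 1))
  refine ⟨δ, fun b hb => ?_⟩
  have : ∃ n, ∀ x ∈ b, x.1 < d n := by
    classical
    induction b using Finset.induction_on with
    | empty => exact ⟨0, by simp⟩
    | insert x b _ ih =>
      obtain ⟨n, hn⟩ := ih fun y hy => hb y (Finset.mem_insert_of_mem hy)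
      obtain ⟨m, hm⟩ := hcof x.1 (hb x (Finset.mem_insert_self _ _))
      refine ⟨max m n, fun y hy => ?_⟩
      rcases Finset.mem_insert.1 hy with rfl | hy
      · exact hm.trans_le (hmono (le_max_left _ _))
      · exact (hn y hy).trans_le (hmono (le_max_right _ _))
  obtain ⟨n, hn⟩ := this
  exact ((hγ _ b hn).trans_eq (hds n).symm).trans (hδ (n + 1))

end Order

/-! ### Making a set of points isolated -/

/-- The topology on `Z ∪ R` in which the points outside `Z` are isolated, while the points of `Z`
keep their neighbourhoods from the ambient space. -/
abbrev isolatingTopology {C : Type*} [TopologicalSpace C] (Z R : Set C) :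
    TopologicalSpace ↥(Z ∪ R) where
  IsOpen U := ∀ y ∈ U, (y : C) ∈ Z → ∃ V, IsOpen V ∧ (y : C) ∈ V ∧ Subtype.val ⁻¹' V ⊆ U
  isOpen_univ _ _ _ := ⟨univ, isOpen_univ, mem_univ _, subset_univ _⟩
  isOpen_inter U₁ U₂ h₁ h₂ y hy hyZ := by
    obtain ⟨V₁, hV₁, hy₁, hs₁⟩ := h₁ y hy.1 hyZ
    obtain ⟨V₂, hV₂, hy₂, hs₂⟩ := h₂ y hy.2 hyZ
    exact ⟨V₁ ∩ V₂, hV₁.inter hV₂, ⟨hy₁, hy₂⟩, inter_subset_inter hs₁ hs₂⟩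
  isOpen_sUnion 𝒰 h y hy hyZ := by
    obtain ⟨U, hU, hyU⟩ := hy
    obtain ⟨V, hV, hyV, hs⟩ := h U hU y hyU hyZ
    exact ⟨V, hV, hyV, hs.trans (subset_sUnion_of_mem hU)⟩

section Isolating

variable {C : Type*} [TopologicalSpace C] {Z R : Set C}

/-- `Z ∪ R` is Lindelöf when `Z` is Lindelöf and `R` is concentrated on `Z`. -/
theorem lindelofSpace_isolatingTopology (hZ : IsLindelof Z)
    (hR : ∀ U, IsOpen U → Z ⊆ U → (R \ U).Countable) :
    @LindelofSpace _ (isolatingTopology Z R) := by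
  let := isolatingTopology Z R
  rw [← isLindelof_univ_iff]
  refine isLindelof_of_countable_subcover fun {ι} U hU hcov => ?_
  have hpt : ∀ y : ↥(Z ∪ R), ∃ i, y ∈ U i := fun y => mem_iUnion.1 (hcov (mem_univ y))
  have hV : ∀ z ∈ Z, ∃ i V, IsOpen V ∧ z ∈ V ∧ (Subtype.val ⁻¹' V : Set ↥(Z ∪ R)) ⊆ U i := by
    intro z hz
    obtain ⟨i, hi⟩ := hpt ⟨z, Or.inl hz⟩
    exact ⟨i, hU i _ hi hz⟩
  rcases isEmpty_or_nonempty ι with hι | hι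
  · exact ⟨∅, countable_empty, fun y _ => hι.elim (hpt y).choose⟩
  choose! i V hVo hzV hVU using hV
  obtain ⟨t, ht, htZ, hcovt⟩ := hZ.elim_nhds_subcover V
    fun z hz => (hVo z hz).mem_nhds (hzV z hz)
  have hcount := hR (⋃ z ∈ t, V z) (isOpen_biUnion fun z hz => hVo z (htZ z hz)) hcovt
  choose k hk using hpt
  have hcount' : {y : ↥(Z ∪ R) | (y : C) ∈ R \ ⋃ z ∈ t, V z}.Countable :=
    hcount.preimage Subtype.val_injective
  refine ⟨i '' t ∪ k '' {y | (y : C) ∈ R \ ⋃ z ∈ t, V z},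
    (ht.image i).union (hcount'.image k), fun y _ => ?_⟩
  by_cases hy : (y : C) ∈ ⋃ z ∈ t, V z
  · simp only [mem_iUnion] at hy
    obtain ⟨z, hz, hy⟩ := hy
    exact mem_biUnion (Or.inl (mem_image_of_mem i hz)) (hVU z (htZ z hz) hy)
  · have hyR : (y : C) ∈ R := y.2.resolve_left fun h => hy (hcovt h)
    exact mem_biUnion (Or.inr (mem_image_of_mem k ⟨hyR, hy⟩)) (hk y)

/-- When `Z` misses `X ⊇ R`, the diagonal of `R` is closed and discrete in `X × (Z ∪ R)`. -/
theorem countable_of_lindelofSpace_prod_isolatingTopology [T2Space C] {X : Set C} (hRX : R ⊆ X)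
    (hZX : Disjoint Z X)
    (h : @LindelofSpace (X × ↥(Z ∪ R)) (@instTopologicalSpaceProd _ _ _ (isolatingTopology Z R))) :
    R.Countable := by
  let := isolatingTopology Z R
  have hval : Continuous (Subtype.val : ↥(Z ∪ R) → C) :=
    continuous_def.2 fun V hV y hy _ => ⟨V, hV, hy, subset_rfl⟩
  have hcl : IsClosed {p : X × ↥(Z ∪ R) | (p.1 : C) = p.2} :=
    isClosed_eq (continuous_subtype_val.comp continuous_fst) (hval.comp continuous_snd)
  obtain ⟨t, ht, hcov⟩ := hcl.isLindelof.elim_countable_subcover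
    (fun x : X => {p : X × ↥(Z ∪ R) | (p.2 : C) = x})
    (fun x => by
      have ho : IsOpen {y : ↥(Z ∪ R) | (y : C) = x} := fun y hy hyZ =>
        absurd (show (y : C) ∈ X from (show (y : C) = x from hy) ▸ x.2)
          (Set.disjoint_left.1 hZX hyZ)
      exact ho.preimage continuous_snd)
    (fun p hp => mem_iUnion.2 ⟨p.1, hp.symm⟩)
  refine (ht.image Subtype.val).mono fun y hy => ?_
  have := @hcov (⟨y, hRX hy⟩, ⟨y, Or.inr hy⟩) rfl
  simp only [mem_iUnion] at this
  obtain ⟨x, hx, hxy⟩ := this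
  exact ⟨x, hx, hxy.symm⟩

end Isolating

/-! ### Remainders in uncountable powers -/

section Product

variable {J S : Type*} [LinearOrder J]

/-- The points of the power `J → S` none of whose coordinates below `δ` lies in `N`. -/
def avoidBelow (N : Set S) (δ : J) : Set (J → S) := {x | ∀ β < δ, x β ∉ N}

theorem avoidBelow_antitone (N : Set S) : Antitone (avoidBelow (J := J) N) :=
  fun _ _ h _ hx β hβ => hx β (hβ.trans_le h)

theorem avoidBelow_eq_preimage (N : Set S) (δ : J) :
    avoidBelow N δ = (Iio δ).domRestrict ⁻¹' {t : Iio δ → S | ∀ i, t i ∉ N} := by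
  ext x
  exact ⟨fun h i => h i.1 i.2, fun h β hβ => h ⟨β, hβ⟩⟩

/-- The points outside `X` that avoid `N` below `δ` and whose restriction to the coordinates below
`δ` is not the restriction of a point of `X`. -/
def refutedBelow (N : Set S) (X : Set (J → S)) (δ : J) : Set (J → S) :=
  (Iio δ).domRestrict ⁻¹' ({t | ∀ i, t i ∉ N} \ (Iio δ).domRestrict '' X)

/-- The points outside `X` that are recognised as such by an initial segment of their coordinates
before a coordinate in `N` occurs. -/
def remainder (N : Set S) (X : Set (J → S)) : Set (J → S) := ⋃ δ : J, refutedBelow N X δ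

theorem refutedBelow_subset_avoidBelow (N : Set S) (X : Set (J → S)) (δ : J) :
    refutedBelow N X δ ⊆ avoidBelow N δ := by
  rw [avoidBelow_eq_preimage]
  exact fun _ h => h.1

theorem disjoint_remainder (N : Set S) (X : Set (J → S)) : Disjoint (remainder N X) X := by
  rw [Set.disjoint_left]
  intro x hx hxX
  obtain ⟨δ, -, hδ⟩ := mem_iUnion.1 hx
  exact hδ ⟨x, hxX, rfl⟩

variable [TopologicalSpace S]

/-- A Lindelöf subset of a power is determined by its projections to the initial segments. -/
theorem mem_of_forall_exists_restrict_mem [T1Space S] [Uncountable J]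
    (hJ : ∀ δ : J, (Iio δ).Countable) {X : Set (J → S)} (hX : IsLindelof X) {z : J → S}
    (hz : ∀ δ : J, ∃ δ' ≥ δ, (Iio δ').domRestrict z ∈ (Iio δ').domRestrict '' X) : z ∈ X := by
  by_contra hzX
  obtain ⟨t, ht, hcov⟩ := hX.elim_countable_subcover (fun α : J => {y | y α ≠ z α})
    (fun α => isOpen_compl_singleton.preimage (continuous_apply α))
    (fun x hx => by
      obtain ⟨α, hα⟩ := Function.ne_iff.1 (show x ≠ z from fun h => hzX (h ▸ hx))
      exact mem_iUnion.2 ⟨α, hα⟩)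
  obtain ⟨δ, hδ⟩ := exists_strict_upper_bound_of_countable hJ ht
  obtain ⟨δ', hδ', x, hx, hxz⟩ := hz δ
  have := hcov hx
  simp only [mem_iUnion] at this
  obtain ⟨α, hα, hne⟩ := this
  exact hne (congrFun hxz ⟨α, (hδ α hα).trans_le hδ'⟩)

/-- Boxes with finitely many sides from a basis `B` of `S`, encoded as finite subsets of `J × B`, form
neighbourhood bases in the initial products, together with their closures. -/
theorem exists_box_closure_subset [RegularSpace S] {B : Set (Set S)}
    (hB : TopologicalSpace.IsTopologicalBasis B) {δ : J} {V : Set (Iio δ → S)} (hV : IsOpen V)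
    {t : Iio δ → S} (ht : t ∈ V) :
    ∃ b : Finset (J × B), (∀ p ∈ b, p.1 < δ) ∧
      (∀ x : J → S, (Iio δ).domRestrict x = t → ∀ p ∈ b, x p.1 ∈ (p.2 : Set S)) ∧
      ∀ x : J → S, (∀ p ∈ b, x p.1 ∈ closure (p.2 : Set S)) → (Iio δ).domRestrict x ∈ V := by
  classical
  obtain ⟨F, u, hu, hsub⟩ := isOpen_pi_iff.1 hV t ht
  have hW : ∀ i ∈ F, ∃ W : B, t i ∈ (W : Set S) ∧ closure (W : Set S) ⊆ u i := by
    intro i hi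
    obtain ⟨W, hWB, htW, hWu⟩ := hB.exists_closure_subset ((hu i hi).1.mem_nhds (hu i hi).2)
    exact ⟨⟨W, hWB⟩, htW, hWu⟩
  choose W htW hWu using hW
  refine ⟨F.attach.image fun i => (i.1.1, W i.1 i.2), ?_, ?_, ?_⟩
  · intro p hp
    obtain ⟨i, -, rfl⟩ := Finset.mem_image.1 hp
    exact i.1.2
  · rintro x rfl p hp
    obtain ⟨i, -, rfl⟩ := Finset.mem_image.1 hp
    exact htW i.1 i.2
  · intro x hx
    refine hsub fun i hi => hWu i hi ?_
    exact hx _ (Finset.mem_image.2 ⟨⟨i, hi⟩, Finset.mem_attach _ _, rfl⟩)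

theorem isLindelof_preimage_restrict [CompactSpace S] [T2Space S] [SecondCountableTopology S]
    (hJ : ∀ δ : J, (Iio δ).Countable) (δ : J) (T : Set (Iio δ → S)) :
    IsLindelof ((Iio δ).domRestrict ⁻¹' T : Set (J → S)) := by
  have := (hJ δ).to_subtype
  exact (Pi.continuous_domRestrict (Iio δ)).isProperMap.isLindelof_preimage
    (HereditarilyLindelofSpace.isLindelof T)

/-- If, on each initial segment `δ`, the closure of the projection of `K ∩ avoidBelow N δ` is
contained in the projection of `X` on some open set that meets the projection, then `K` misses
`avoidBelow N δ` for some `δ`.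

Otherwise the open sets can be taken to be finite boxes, and by pressing down one and the same box
works for cofinally many `δ`. The points of its closure whose restrictions lie in all the closures
then form a compact subset of `X`, hence one contained in `{x | x β ∈ N}` for a single `β`. As this is
a `G_δ` set, compactness gives the same inclusion at some stage `δ > β`, where the box still contains
a point of `avoidBelow N δ`. -/
theorem exists_disjoint_avoidBelow [CompactSpace S] [T2Space S] [SecondCountableTopology S]
    [WellFoundedLT J] [Uncountable J] (hJ : ∀ δ : J, (Iio δ).Countable)
    {N : Set S} (hN : IsGδ N) {X : Set (J → S)} (hX : IsLindelof X)
    (hcov : ∀ K ⊆ X, IsCompact K → ∃ β, ∀ x ∈ K, x β ∈ N) {K : Set (J → S)}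
    (hloc : ∀ δ : J, (K ∩ avoidBelow N δ).Nonempty → ∃ V : Set (Iio δ → S), IsOpen V ∧
      (V ∩ (Iio δ).domRestrict '' (K ∩ avoidBelow N δ)).Nonempty ∧
      V ∩ closure ((Iio δ).domRestrict '' (K ∩ avoidBelow N δ)) ⊆ (Iio δ).domRestrict '' X) :
    ∃ δ : J, Disjoint K (avoidBelow N δ) := by
  by_contra! hne
  replace hne : ∀ δ : J, (K ∩ avoidBelow N δ).Nonempty :=
    fun δ => not_disjoint_iff_nonempty_inter.1 (hne δ)
  let B := TopologicalSpace.countableBasis S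
  have hB : TopologicalSpace.IsTopologicalBasis B := TopologicalSpace.isBasis_countableBasis S
  have : Countable B := (TopologicalSpace.countable_countableBasis S).to_subtype
  let P : J → Set (J → S) := fun δ =>
    (Iio δ).domRestrict ⁻¹' closure ((Iio δ).domRestrict '' (K ∩ avoidBelow N δ))
  have hPcl : ∀ δ, IsClosed (P δ) := fun δ =>
    isClosed_closure.preimage (Pi.continuous_domRestrict _)
  have hKP : ∀ δ, K ∩ avoidBelow N δ ⊆ P δ := fun δ x hx => subset_closure ⟨x, hx, rfl⟩
  have hPanti : Antitone P := by
    intro δ δ' h x hx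
    have hc : Continuous (Set.domRestrict₂ (π := fun _ : J => S) (Iio_subset_Iio h)) :=
      continuous_pi fun i => continuous_apply _
    have := image_closure_subset_closure_image hc (mem_image_of_mem _ hx)
    refine closure_mono ?_ this
    rintro _ ⟨_, ⟨y, hy, rfl⟩, rfl⟩
    exact ⟨y, ⟨hy.1, avoidBelow_antitone N h hy.2⟩, rfl⟩
  -- The box `b` witnesses the hypothesis `hloc` at `δ`.
  let Good : Finset (J × B) → J → Prop := fun b δ =>
    (∃ x ∈ K ∩ avoidBelow N δ, ∀ p ∈ b, x p.1 ∈ (p.2 : Set S)) ∧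
    ∀ x ∈ P δ, (∀ p ∈ b, x p.1 ∈ closure (p.2 : Set S)) →
      (Iio δ).domRestrict x ∈ (Iio δ).domRestrict '' X
  have hgood : ∀ δ, ∃ b, (∀ p ∈ b, p.1 < δ) ∧ Good b δ := by
    intro δ
    obtain ⟨V, hV, ⟨_, hxV, x, hx, rfl⟩, hVX⟩ := hloc δ (hne δ)
    obtain ⟨b, hb, hb₁, hb₂⟩ := exists_box_closure_subset hB hV hxV
    exact ⟨b, hb, ⟨x, hx, hb₁ x rfl⟩, fun y hy hyb => hVX ⟨hb₂ y hyb, hy⟩⟩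
  have hbdd : ∀ b, ∃ γ, ∀ δ, Good b δ → δ ≤ γ := by
    intro b
    by_contra! hunb
    let box : Set (J → S) := {x | ∀ p ∈ b, x p.1 ∈ closure (p.2 : Set S)}
    have hbox : IsClosed box := by
      have : box = ⋂ p ∈ b, (fun x : J → S => x p.1) ⁻¹' closure (p.2 : Set S) := by
        ext x; simp [box]
      rw [this]
      exact isClosed_biInter fun p _ => isClosed_closure.preimage (continuous_apply _)
    let Γ := {δ // Good b δ}
    have : Nonempty Γ := by
      obtain ⟨δ, h, -⟩ := hunb (Classical.arbitrary J)
      exact ⟨⟨δ, h⟩⟩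
    let L : Γ → Set (J → S) := fun δ => box ∩ P δ
    have hLcl : ∀ i, IsClosed (L i) := fun i => hbox.inter (hPcl i)
    have hLdir : Directed (· ⊇ ·) L := by
      have : Antitone L := fun i j h => inter_subset_inter_right _ (hPanti h)
      exact this.directed_ge
    have hLX : (⋂ i, L i) ⊆ X := by
      intro z hz
      rw [mem_iInter] at hz
      refine mem_of_forall_exists_restrict_mem hJ hX fun δ => ?_
      obtain ⟨δ', h, hlt⟩ := hunb δ
      exact ⟨δ', hlt.le, h.2 z (hz ⟨δ', h⟩).2 (hz ⟨δ', h⟩).1⟩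
    obtain ⟨β, hβ⟩ := hcov _ hLX (isClosed_iInter hLcl).isCompact
    obtain ⟨O, hO, hNO⟩ := hN.eq_iInter_nat
    have hsub : ∀ n, ∃ i, L i ⊆ (fun x : J → S => x β) ⁻¹' O n := by
      intro n
      refine exists_subset_nhds_of_isCompact' hLdir (fun i => (hLcl i).isCompact) hLcl fun x hx => ?_
      have := hβ x hx
      rw [hNO, mem_iInter] at this
      exact ((hO n).preimage (continuous_apply β)).mem_nhds (this n)
    choose i hi using hsub
    obtain ⟨δ₀, hδ₀⟩ := exists_strict_upper_bound_of_countable hJ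
      ((countable_range fun n => (i n : J)).insert β)
    obtain ⟨δ, hδ, hlt⟩ := hunb δ₀
    obtain ⟨x, hx, hxb⟩ := hδ.1
    refine hx.2 β ((hδ₀ β (mem_insert _ _)).trans hlt) ?_
    rw [hNO, mem_iInter]
    intro n
    refine hi n ⟨fun p hp => subset_closure (hxb p hp), ?_⟩
    exact hPanti ((hδ₀ _ (mem_insert_of_mem _ (mem_range_self n))).trans hlt).le (hKP δ hx)
  choose γ hγ using hbdd
  obtain ⟨δ, hδ⟩ := exists_closed_under_finset_map hJ γ
  obtain ⟨b, hb, hbg⟩ := hgood δ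
  exact absurd (hδ b hb) (not_lt.2 (hγ b δ hbg))

end Product

/-! ### Covers by closed sets that depend on one coordinate -/

/-- Otherwise there are points `a δ ∈ X ∩ avoidBelow N δ`. Isolating them in `remainder N X ∪ range a`
gives a Lindelöf space whose product with `X` is not Lindelöf. -/
theorem exists_forall_exists_lt_mem {J S : Type} [LinearOrder J] [WellFoundedLT J] [Uncountable J]
    (hJ : ∀ δ : J, (Iio δ).Countable) [TopologicalSpace S] [CompactSpace S]
    [TopologicalSpace.MetrizableSpace S]
    (hMichael : ∃ (Y : Type u) (_ : TopologicalSpace Y), IsMichaelSpace Y)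
    {N : Set S} (hN : IsClosed N) {X : Set (J → S)} (hX : ProductivelyLindelof.{u} X)
    (hcov : ∀ K ⊆ X, IsCompact K → ∃ β, ∀ x ∈ K, x β ∈ N) :
    ∃ δ : J, ∀ x ∈ X, ∃ β < δ, x β ∈ N := by
  obtain ⟨M, _, hML, hM⟩ := hMichael
  obtain ⟨hXL, hXprod⟩ := hX
  have hXl : IsLindelof X := isLindelof_iff_lindelofSpace.2 hXL
  let := TopologicalSpace.metrizableSpaceMetric S
  have hcountJ : ∀ δ : J, Countable (Iio δ) := fun δ => (hJ δ).to_subtype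
  by_contra! hnot
  choose a haX haN using hnot
  -- It suffices to treat the compact complement of `U`, where the projections of
  -- `avoidBelow N δ` are `G_δ` subsets of the projections of `X`.
  have hkey : ∀ U, IsOpen U → remainder N X ⊆ U → ∃ δ : J, avoidBelow N δ ⊆ U := by
    intro U hU hZU
    have hK : IsCompact Uᶜ := hU.isClosed_compl.isCompact
    obtain ⟨δ, hδ⟩ := exists_disjoint_avoidBelow hJ hN.isGδ hXl hcov (K := Uᶜ) (by
      intro δ hne
      refine exists_open_inter_closure_subset ?_ ?_ (hne.image _) hM ?_
      · rw [avoidBelow_eq_preimage, image_inter_preimage]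
        refine (hK.image (Pi.continuous_domRestrict _)).isClosed.isGδ.inter ?_
        have : {t : Iio δ → S | ∀ i, t i ∉ N} = ⋂ i, (fun t => t i) ⁻¹' Nᶜ := by
          ext t; simp
        rw [this]
        exact .iInter_of_isOpen fun i => hN.isOpen_compl.preimage (continuous_apply i)
      · rintro _ ⟨x, hx, rfl⟩
        by_contra hxX
        rw [avoidBelow_eq_preimage] at hx
        exact hx.1 (hZU (mem_iUnion.2 ⟨δ, hx.2, hxX⟩))
      · have := hXprod M hML
        have hc : Continuous fun p : X × M =>
            ((⟨(Iio δ).domRestrict (p.1 : J → S), mem_image_of_mem _ p.1.2⟩, p.2) :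
              ((Iio δ).domRestrict '' X : Set (Iio δ → S)) × M) :=
          (((Pi.continuous_domRestrict (Iio δ)).comp
            (continuous_subtype_val.comp continuous_fst)).subtype_mk _).prodMk continuous_snd
        refine LindelofSpace.of_continuous_surjective hc ?_
        rintro ⟨⟨_, x, hx, rfl⟩, m⟩
        exact ⟨(⟨x, hx⟩, m), rfl⟩)
    exact ⟨δ, fun x hx => by_contra fun hxU => Set.disjoint_left.1 hδ hxU hx⟩
  have hZ : IsLindelof (remainder N X) := by
    refine isLindelof_of_countable_subcover fun {ι} U hU hcovU => ?_
    obtain ⟨δ, hδ⟩ := hkey _ (isOpen_iUnion hU) hcovU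
    have hlind : IsLindelof (avoidBelow N δ ∪ ⋃ γ ∈ Iio δ, refutedBelow N X γ) := by
      refine IsLindelof.union ?_ ((hJ δ).isLindelof_biUnion fun γ _ =>
        isLindelof_preimage_restrict hJ γ _)
      rw [avoidBelow_eq_preimage]
      exact isLindelof_preimage_restrict hJ δ _
    obtain ⟨t, ht, hcovt⟩ := hlind.elim_countable_subcover U hU
      (union_subset hδ (iUnion₂_subset fun γ _ => (subset_iUnion _ γ).trans hcovU))
    refine ⟨t, ht, fun z hz => hcovt ?_⟩
    obtain ⟨γ, hγ⟩ := mem_iUnion.1 hz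
    rcases lt_or_ge γ δ with h | h
    · exact Or.inr (mem_biUnion h hγ)
    · exact Or.inl (avoidBelow_antitone N h (refutedBelow_subset_avoidBelow N X γ hγ))
  have hYL : @LindelofSpace _ (isolatingTopology (remainder N X) (range a)) := by
    refine lindelofSpace_isolatingTopology hZ fun U hU hZU => ?_
    obtain ⟨δ, hδ⟩ := hkey U hU hZU
    refine ((hJ δ).image a).mono ?_
    rintro _ ⟨⟨ε, rfl⟩, hε⟩
    refine ⟨ε, not_le.1 fun h => hε (hδ fun β hβ => haN ε β (hβ.trans_le h)), rfl⟩
  have hcount : (range a).Countable := by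
    let := isolatingTopology (remainder N X) (range a)
    refine countable_of_lindelofSpace_prod_isolatingTopology (X := X) (range_subset_iff.2 haX)
      (disjoint_remainder N X) ?_
    -- `ULift` moves the space into the universe over which `hX` quantifies.
    have : LindelofSpace (ULift.{u} ↥(remainder N X ∪ range a)) :=
      .of_continuous_surjective continuous_uliftUp ULift.up_surjective
    have := hXprod _ this
    exact .of_continuous_surjective (f := fun p : X × ULift.{u} ↥(remainder N X ∪ range a) =>
      (p.1, p.2.down)) (continuous_fst.prodMk (continuous_uliftDown.comp continuous_snd))
      fun p => ⟨(p.1, ⟨p.2⟩), rfl⟩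
  have hβ : ∀ x ∈ X, ∃ β, x β ∈ N := fun x hx => by
    obtain ⟨β, hβ⟩ := hcov {x} (singleton_subset_iff.2 hx) isCompact_singleton
    exact ⟨β, hβ x rfl⟩
  choose! β hβ using hβ
  obtain ⟨δ, hδ⟩ := exists_strict_upper_bound_of_countable hJ (hcount.image β)
  exact haN δ _ (hδ _ (mem_image_of_mem β (mem_range_self δ))) (hβ _ (haX δ))

/-! ### From `G_δ` sets to closed sets -/

section Reduction

variable {J : Type} {T : Type*} [TopologicalSpace T]

/-- The pairs of a point `x ∈ X` of a power of `T` and a family `t` of numbers in `[0,1]` such that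
`x` avoids `⋂ i ≤ k, O α i` whenever `t α > 1 / (k + 1)`. For `t α = 0` this is no condition at
`α`, and for `x ∈ ⋂ i, O α i` it forces `t α = 0`. The pair is encoded as one family in
`T × [0,1]`. -/
def avoidanceGraph (X : Set (J → T)) (O : J → ℕ → Set (J → T)) : Set (J → T × I) :=
  {g | (fun α => (g α).1) ∈ X ∧
    ∀ α (k : ℕ), 1 / ((k : ℝ) + 1) < (g α).2 → ∃ i ≤ k, (fun α => (g α).1) ∉ O α i}

/-- The graph is the continuous image of a closed subspace of `X × [0,1]^J`, and a product with a
compact space preserves productive Lindelöfness. -/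
theorem productivelyLindelof_avoidanceGraph {X : Set (J → T)} (hX : ProductivelyLindelof.{u} X)
    {O : J → ℕ → Set (J → T)} (hO : ∀ α k, IsOpen (O α k)) :
    ProductivelyLindelof.{u} (avoidanceGraph X O) := by
  have hprod : ∀ (Y : Type u) [TopologicalSpace Y], LindelofSpace Y →
      LindelofSpace (avoidanceGraph X O × Y) := by
    intro Y _ _
    have := CompactSpace.lindelofSpace_prod (J → I) Y
    have hL : LindelofSpace (X × ((J → I) × Y)) := hX.2 _ this
    let W : Set (X × ((J → I) × Y)) :=
      {p | ∀ α (k : ℕ), 1 / ((k : ℝ) + 1) < p.2.1 α → ∃ i ≤ k, (p.1 : J → T) ∉ O α i}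
    have hW : IsClosed W := by
      have : W = ⋂ (α : J) (k : ℕ), {p | ((p.2.1 α : I) : ℝ) ≤ 1 / ((k : ℝ) + 1)} ∪
          ⋃ i ∈ Finset.range (k + 1), (fun p => (p.1 : J → T)) ⁻¹' (O α i)ᶜ := by
        ext p
        simp only [W, mem_iInter, mem_union, mem_ofPred_eq, mem_iUnion, Finset.mem_range,
          Nat.lt_succ_iff, mem_preimage, mem_compl_iff, exists_prop]
        refine forall_congr' fun α => forall_congr' fun k => ?_
        rw [← not_lt, imp_iff_not_or]
      rw [this]
      refine isClosed_iInter fun α => isClosed_iInter fun k => IsClosed.union ?_ ?_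
      · refine isClosed_le ?_ continuous_const
        fun_prop
      · exact isClosed_biUnion_finset fun i _ =>
          (hO α i).isClosed_compl.preimage (by fun_prop)
    have : LindelofSpace W := isLindelof_iff_lindelofSpace.1 hW.isLindelof
    let φ : W → avoidanceGraph X O × Y := fun p =>
      (⟨fun α => ((p.1.1 : J → T) α, p.1.2.1 α), p.1.1.2, p.2⟩, p.1.2.2)
    have hφ : Continuous φ := by
      have h : Continuous fun p : W => (p.1.1 : J → T) :=
        continuous_subtype_val.comp (continuous_fst.comp continuous_subtype_val)
      refine Continuous.prodMk (Continuous.subtype_mk (continuous_pi fun α => ?_) _) (by fun_prop)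
      exact ((continuous_apply α).comp h).prodMk (by fun_prop)
    refine LindelofSpace.of_continuous_surjective hφ ?_
    rintro ⟨⟨g, hgX, hg⟩, y⟩
    exact ⟨⟨(⟨fun α => (g α).1, hgX⟩, (fun α => (g α).2, y)), hg⟩, rfl⟩
  refine ⟨?_, hprod⟩
  have := hprod PUnit.{u + 1} inferInstance
  exact LindelofSpace.of_continuous_surjective (f := Prod.fst (α := avoidanceGraph X O))
    continuous_fst fun g => ⟨(g, PUnit.unit), rfl⟩

end Reduction

/-- Over `avoidanceGraph X O`, with `G α = ⋂ n, O α n`, the `G_δ` sets `G α` are replaced by the closed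
sets `t α = 0`: a compact set of pairs lies in one of these as soon as its projection lies in `G α`,
and a point `x` outside `G α` lifts to a pair with `t α ≠ 0`. -/
theorem exists_countable_subcover_of_isGδ {J T : Type} [LinearOrder J] [WellFoundedLT J]
    [Uncountable J] (hJ : ∀ δ : J, (Iio δ).Countable) [TopologicalSpace T] [CompactSpace T]
    [TopologicalSpace.MetrizableSpace T]
    (hMichael : ∃ (Y : Type u) (_ : TopologicalSpace Y), IsMichaelSpace Y)
    {X : Set (J → T)} (hX : ProductivelyLindelof.{u} X) {G : J → Set (J → T)}
    (hG : ∀ α, IsGδ (G α)) (hcov : ∀ K ⊆ X, IsCompact K → ∃ α, K ⊆ G α) :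
    ∃ δ : J, X ⊆ ⋃ α ∈ Iio δ, G α := by
  have hO : ∀ α, ∃ O : ℕ → Set (J → T), (∀ n, IsOpen (O n)) ∧ G α = ⋂ n, O n :=
    fun α => (hG α).eq_iInter_nat
  choose O hO hGO using hO
  obtain ⟨δ, hδ⟩ := exists_forall_exists_lt_mem hJ hMichael (N := {s : T × I | s.2 = 0})
    (isClosed_eq continuous_snd continuous_const) (productivelyLindelof_avoidanceGraph hX hO) (by
      intro K hKX hK
      have hc : Continuous fun (g : J → T × I) α => (g α).1 := by fun_prop
      obtain ⟨α, hα⟩ := hcov _ (image_subset_iff.2 fun g hg => (hKX hg).1) (hK.image hc)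
      refine ⟨α, fun g hg => ?_⟩
      by_contra hne
      have hpos : 0 < ((g α).2 : ℝ) :=
        lt_of_le_of_ne (g α).2.2.1 fun h => hne (Subtype.ext h.symm)
      obtain ⟨k, hk⟩ := exists_nat_one_div_lt hpos
      obtain ⟨i, -, hi⟩ := (hKX hg).2 α k hk
      have := hα (mem_image_of_mem _ hg)
      rw [hGO, mem_iInter] at this
      exact hi (this i))
  refine ⟨δ, fun x hx => ?_⟩
  -- Lift an uncovered `x` to a pair `(x, t)` with `t α ≠ 0` at every `α` with `x ∉ G α`.
  by_contra hxG
  simp only [mem_iUnion, not_exists] at hxG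
  have ht : ∀ α, ∃ t : I, (∀ k : ℕ, 1 / ((k : ℝ) + 1) < t → ∃ i ≤ k, x ∉ O α i) ∧
      (x ∉ G α → t ≠ 0) := by
    intro α
    by_cases hα : x ∈ G α
    · refine ⟨0, fun k hk => absurd hk (not_lt.2 ?_), fun h => absurd hα h⟩
      simp only [Icc.coe_zero]
      positivity
    · obtain ⟨m, hm⟩ : ∃ m, x ∉ O α m := by
        rw [hGO, mem_iInter] at hα
        exact not_forall.1 hα
      refine ⟨⟨1 / ((m : ℝ) + 1), by positivity, ?_⟩, fun k hk => ⟨m, ?_, hm⟩, fun _ h => ?_⟩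
      · rw [div_le_one (by positivity)]
        linarith [(m.cast_nonneg : (0 : ℝ) ≤ m)]
      · have := (one_div_lt_one_div (by positivity) (by positivity)).1 hk
        have : (m : ℝ) < k := by linarith
        exact_mod_cast this.le
      · have h0 : 1 / ((m : ℝ) + 1) = 0 := congrArg Subtype.val h
        exact absurd h0 (by positivity)
  choose t ht ht0 using ht
  obtain ⟨β, hβ, hβ0⟩ := hδ (fun α => (x α, t α)) ⟨hx, ht⟩
  exact ht0 β (hxG β hβ) hβ0

theorem corollary3p4
    (hMichael : ∃ (Y : Type u) (_ : TopologicalSpace Y), IsMichaelSpace Y)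
    (X : Set TychonoffCube) (hX : ProductivelyLindelof.{u} X)
    (𝒢 : Set (Set TychonoffCube))
    (hAlster : IsAlsterCovering X ((fun G => (Subtype.val ⁻¹' G : Set X)) '' 𝒢))
    (hcard : #𝒢 = ℵ₁)
    (hGδ : ∀ G ∈ 𝒢, IsGδ G) (hLind : ∀ G ∈ 𝒢, IsLindelof G) :
    ∃ 𝒢' : Set (Set TychonoffCube), 𝒢' ⊆ 𝒢 ∧ #𝒢' = ℵ₀ ∧ X ⊆ ⋃₀ 𝒢' := by
  have hJcard : #(ω₁ : Ordinal.{0}).ToType = ℵ₁ := by simp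
  have : Uncountable (ω₁ : Ordinal.{0}).ToType := by
    rw [← Cardinal.aleph0_lt_mk_iff, hJcard]
    exact Cardinal.aleph0_lt_aleph_one
  have hJ : ∀ δ : (ω₁ : Ordinal.{0}).ToType, (Iio δ).Countable := by
    intro δ
    rw [← Cardinal.le_aleph0_iff_set_countable, ← Cardinal.lt_aleph_one_iff]
    exact (Cardinal.mk_Iio_lt δ (by simp)).trans_eq hJcard
  obtain ⟨e⟩ : Nonempty ((ω₁ : Ordinal.{0}).ToType ≃ 𝒢) := Cardinal.eq.1 (hJcard.trans hcard.symm)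
  obtain ⟨δ, hδ⟩ := exists_countable_subcover_of_isGδ hJ hMichael hX
    (G := fun α => (e α : Set TychonoffCube)) (fun α => hGδ _ (e α).2) (by
      intro K hKX hK
      obtain ⟨_, ⟨G, hG, rfl⟩, hKG⟩ := hAlster.2 (Subtype.val ⁻¹' K)
        (Topology.IsInducing.subtypeVal.isCompact_preimage_iff (by simpa using hKX) |>.2 hK)
      refine ⟨e.symm ⟨G, hG⟩, fun x hx => ?_⟩
      simpa using hKG (show (⟨x, hKX hx⟩ : X) ∈ Subtype.val ⁻¹' K from hx))
  have hinf : 𝒢.Infinite := by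
    rw [← Set.infinite_coe_iff, Cardinal.infinite_iff, hcard]
    exact Cardinal.aleph0_lt_aleph_one.le
  let f := hinf.natEmbedding
  refine ⟨(fun α => (e α : Set TychonoffCube)) '' Iio δ ∪ range fun n => (f n : Set _), ?_, ?_, ?_⟩
  · rintro _ (⟨α, -, rfl⟩ | ⟨n, rfl⟩)
    · exact (e α).2
    · exact (f n).2
  · refine le_antisymm (Cardinal.le_aleph0_iff_set_countable.2
      (((hJ δ).image _).union (countable_range _))) ?_
    rw [← Cardinal.infinite_iff, Set.infinite_coe_iff]
    exact (infinite_range_of_injective (Subtype.val_injective.comp f.injective)).mono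
      subset_union_right
  · intro x hx
    obtain ⟨α, hα, hxα⟩ := mem_iUnion₂.1 (hδ hx)
    exact ⟨_, Or.inl (mem_image_of_mem _ hα), hxα⟩
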